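/- Let $n\ge 0$, $m=n+1$, $D\in\mathbb{R}^{>0}\setminus\{1\}$. Let $U\subset\mathbb{R}^{m}$ be a domain (open, connected, non-empty) invariant under multiplication by positive numbers, and let $h:U\to\mathbb{R}^{>0}$ be a smooth function, homogeneous of degree $D$, such that $-\partial^2h$ is positive definite on the tangent spaces of the hypersurface $\mathcal{H}=\{x\in U\mid h(x)=1\}$. Let $M=\mathbb{R}^{m}+iU\subset\mathbb{C}^{m}$ with holomorphic coordinates $z^\mu=y^\mu+ix^\mu$, $x\in U$, $y\in\mathbb{R}^m$, and let $$g_M=2g_{\mu\bar\nu}\,dz^\mu d\bar z^\nu=g_{\mu\bar\nu}\,(dz^\mu\otimes d\bar z^\nu+d\bar z^\nu\otimes dz^\mu),\qquad g_{\mu\bar\nu}=\partial_{z^\mu}\partial_{\bar z^\nu}K,\qquad K(z)=-\log h(x),$$ be the metric which the generalized supergravity r-map assigns to $\mathcal{H}$ (summation over repeated indices is understood). Put $d(x):=\det(\partial^2h(x))$, $d_\mu=\partial d/\partial x^\mu$, $d_{\mu\nu}=\partial^2d/\partial x^\mu\partial x^\nu$. Then $d$ has no zero on $U$, $g_M$ is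 positive definite on $M$, and the Ricci tensor of (the Levi-Civita connection of) $g_M$, extended complex bilinearly, with $Ric_{\mu\bar\nu}=Ric(\partial_{z^\mu},\partial_{\bar z^\nu})$, is $$Ric_{\mu\bar\nu}=-\partial_{z^\mu}\partial_{\bar z^\nu}\log\frac{|d(x)|}{h(x)^m}\qquad(1\le\mu,\nu\le m).$$ The scalar curvature, in the convention $scal:=\tfrac12\operatorname{tr}_{g_M}Ric=g^{\mu\bar\nu}Ric_{\mu\bar\nu}$, is $$scal=-m^2+\frac{D-2}{D-1}\,m-\frac{h}{d}\,d^\mu{}_\mu+\frac{h}{d^2}\,d^\mu d_\mu,$$ where $h$, $d$ and the derivatives of $d$ are taken at $x$, and indices are raised with the inverse of the metric $-\partial^2h$: if $(h^{\mu\nu})=(\partial^2h)^{-1}$, then $d^\mu{}_\mu=-h^{\mu\nu}d_{\mu\nu}$ and $d^\mu d_\mu=-h^{\mu\nu}d_\mu d_\nu$. -/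

import Mathlib

namespace RMap

noncomputable section

/-! Coordinates: `κ` indexes the complex coordinates `z^μ = y^μ + i x^μ` of `ℂ^κ = (κ → ℂ)`,
and `κ ⊕ κ` indexes the real coordinates, `Sum.inl μ` standing for `y^μ = Re z^μ` and
`Sum.inr μ` for `x^μ = Im z^μ`. -/

section RealCalculus

variable {κ : Type*} [Fintype κ] [DecidableEq κ]

/-- The partial derivative `∂f/∂x^μ` of a function on `ℝ^κ`. -/
def partialDeriv (μ : κ) (f : (κ → ℝ) → ℝ) (x : κ → ℝ) : ℝ :=
  fderiv ℝ f x (Pi.single μ 1)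

/-- The Hessian matrix `∂²f = (f_{μν})`. -/
def hessian (f : (κ → ℝ) → ℝ) (x : κ → ℝ) : Matrix κ κ ℝ :=
  Matrix.of fun μ ν => partialDeriv μ (partialDeriv ν f) x

/-- `d(x) = det (∂²h(x))`. -/
def hessianDet (h : (κ → ℝ) → ℝ) (x : κ → ℝ) : ℝ :=
  (hessian h x).det

/-- The inverse of the metric `-∂²h`, with which indices are raised. -/
def raise (h : (κ → ℝ) → ℝ) (x : κ → ℝ) : Matrix κ κ ℝ :=
  (-hessian h x)⁻¹

/-- `d^μ_μ`, the trace of `∂²d` with respect to the metric `-∂²h`. -/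
def traceHessianDet (h : (κ → ℝ) → ℝ) (x : κ → ℝ) : ℝ :=
  ∑ μ, ∑ ν, raise h x μ ν * hessian (hessianDet h) x μ ν

/-- `d^μ d_μ`, the square of `∂d` with respect to the metric `-∂²h`. -/
def normSqGradHessianDet (h : (κ → ℝ) → ℝ) (x : κ → ℝ) : ℝ :=
  ∑ μ, ∑ ν, raise h x μ ν * partialDeriv μ (hessianDet h) x * partialDeriv ν (hessianDet h) x

end RealCalculus

section RiemannianGeometry

variable {κ : Type*} [Fintype κ] [DecidableEq κ]

/-- The real coordinate vector fields `∂/∂y^μ` and `∂/∂x^μ` on `ℂ^κ`. -/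
def coordVec : κ ⊕ κ → (κ → ℂ)
  | Sum.inl μ => Pi.single μ 1
  | Sum.inr μ => Pi.single μ Complex.I

/-- The derivative of a real function on `ℂ^κ` with respect to a real coordinate. -/
def coordDeriv (i : κ ⊕ κ) (f : (κ → ℂ) → ℝ) (z : κ → ℂ) : ℝ :=
  fderiv ℝ f z (coordVec i)

/-- The Christoffel symbols `Γ^k_{ij}` of the Levi-Civita connection of the metric
`g = ∑ g_{ij} du^i du^j`, where `u` are the real coordinates of `ℂ^κ`. -/
def christoffel (g : (κ → ℂ) → Matrix (κ ⊕ κ) (κ ⊕ κ) ℝ) (k i j : κ ⊕ κ) (z : κ → ℂ) : ℝ :=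
  (1 / 2) * ∑ l, (g z)⁻¹ k l *
    (coordDeriv i (fun w => g w j l) z + coordDeriv j (fun w => g w i l) z
      - coordDeriv l (fun w => g w i j) z)

/-- The Riemann tensor `R^k_{lij}`, i.e. `R(∂_i, ∂_j) ∂_l = ∑ k, R^k_{lij} ∂_k` with
`R(X, Y) = ∇_X ∇_Y - ∇_Y ∇_X - ∇_[X,Y]`. -/
def riemann (g : (κ → ℂ) → Matrix (κ ⊕ κ) (κ ⊕ κ) ℝ) (k l i j : κ ⊕ κ) (z : κ → ℂ) : ℝ :=
  coordDeriv i (christoffel g k j l) z - coordDeriv j (christoffel g k i l) z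
    + ∑ p, (christoffel g k i p z * christoffel g p j l z
      - christoffel g k j p z * christoffel g p i l z)

/-- The Ricci tensor `Ric_{jl} = ∑ i, R^i_{lij}`, i.e. `Ric(Y, Z) = tr (X ↦ R(X, Y) Z)`. -/
def ricci (g : (κ → ℂ) → Matrix (κ ⊕ κ) (κ ⊕ κ) ℝ) (j l : κ ⊕ κ) (z : κ → ℂ) : ℝ :=
  ∑ i, riemann g i l i j z

/-- The component `Ric_{μν̄} = Ric(∂_{z^μ}, ∂_{z̄^ν})` of the complex bilinear extension of the
Ricci tensor, where `∂_{z^μ} = (∂_{y^μ} - i ∂_{x^μ}) / 2` and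
`∂_{z̄^ν} = (∂_{y^ν} + i ∂_{x^ν}) / 2`. -/
def ricciHol (g : (κ → ℂ) → Matrix (κ ⊕ κ) (κ ⊕ κ) ℝ) (μ ν : κ) (z : κ → ℂ) : ℂ :=
  (1 / 4) * ((ricci g (Sum.inl μ) (Sum.inl ν) z : ℂ)
    + Complex.I * (ricci g (Sum.inl μ) (Sum.inr ν) z : ℂ)
    - Complex.I * (ricci g (Sum.inr μ) (Sum.inl ν) z : ℂ)
    + (ricci g (Sum.inr μ) (Sum.inr ν) z : ℂ))

/-- The scalar curvature in the convention of Kähler geometry: one half of the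
trace `∑ g^{ij} Ric_{ij}` of the Ricci tensor with respect to `g`. -/
def scal (g : (κ → ℂ) → Matrix (κ ⊕ κ) (κ ⊕ κ) ℝ) (z : κ → ℂ) : ℝ :=
  (1 / 2) * ∑ i, ∑ j, (g z)⁻¹ i j * ricci g i j z

end RiemannianGeometry

section KaehlerGeometry

variable {κ : Type*} [Fintype κ] [DecidableEq κ]

/-- The Wirtinger derivative `∂_{z^μ} = (∂_{y^μ} - i ∂_{x^μ}) / 2`. -/
def dz (μ : κ) (f : (κ → ℂ) → ℂ) (z : κ → ℂ) : ℂ :=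
  (1 / 2) * (fderiv ℝ f z (Pi.single μ 1) - Complex.I * fderiv ℝ f z (Pi.single μ Complex.I))

/-- The Wirtinger derivative `∂_{z̄^μ} = (∂_{y^μ} + i ∂_{x^μ}) / 2`. -/
def dzbar (μ : κ) (f : (κ → ℂ) → ℂ) (z : κ → ℂ) : ℂ :=
  (1 / 2) * (fderiv ℝ f z (Pi.single μ 1) + Complex.I * fderiv ℝ f z (Pi.single μ Complex.I))

/-- The coefficients `g_{μν̄} = ∂²K / ∂z^μ ∂z̄^ν` of the metric with Kähler potential `K`. -/
def hermCoeff (K : (κ → ℂ) → ℝ) (z : κ → ℂ) (μ ν : κ) : ℂ :=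
  dz μ (dzbar ν fun w => (K w : ℂ)) z

/-- The (real) metric `2 g_{μν̄} dz^μ dz̄^ν = g_{μν̄} (dz^μ ⊗ dz̄^ν + dz̄^ν ⊗ dz^μ)` with Kähler
potential `K`, as a matrix in the real coordinates. For `K` of class `C²` the
coefficients are Hermitian and the sum below is real, so that `re` only changes its type. -/
def kaehlerMetric (K : (κ → ℂ) → ℝ) (z : κ → ℂ) : Matrix (κ ⊕ κ) (κ ⊕ κ) ℝ :=
  Matrix.of fun i j =>
    (∑ μ, ∑ ν, hermCoeff K z μ ν *
      (coordVec i μ * (starRingEnd ℂ) (coordVec j ν)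
        + (starRingEnd ℂ) (coordVec i ν) * coordVec j μ)).re

end KaehlerGeometry

section RMapConstruction

variable {κ : Type*} [Fintype κ] [DecidableEq κ]

/-- The data to which the generalized supergravity r-map applies: a smooth positive function `h`,
homogeneous of degree `D`, on a domain `U ⊆ ℝ^κ` invariant under positive scalings, such that
`-∂²h` is positive definite on the tangent spaces `ker dh_x` of the hypersurface `{h = 1}`. -/
structure IsDatum (D : ℝ) (U : Set (κ → ℝ)) (h : (κ → ℝ) → ℝ) : Prop where
  degree_pos : 0 < D
  degree_ne_one : D ≠ 1
  isOpen : IsOpen U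
  isConnected : IsConnected U
  smul_mem : ∀ t : ℝ, 0 < t → ∀ x ∈ U, t • x ∈ U
  smooth : ContDiffOn ℝ (⊤ : ℕ∞) h U
  pos : ∀ x ∈ U, 0 < h x
  homogeneous : ∀ t : ℝ, 0 < t → ∀ x ∈ U, h (t • x) = t ^ D * h x
  posDef_tangent : ∀ x ∈ U, h x = 1 → ∀ v : κ → ℝ, fderiv ℝ h x v = 0 → v ≠ 0 →
    0 < v ⬝ᵥ ((-hessian h x).mulVec v)

/-- The imaginary part `x = Im z ∈ ℝ^κ` of `z ∈ ℂ^κ`. -/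
def imPart (z : κ → ℂ) : κ → ℝ := fun μ => (z μ).im

/-- The manifold `M = ℝ^κ + i U`, an open subset of `ℂ^κ`. -/
def tube (U : Set (κ → ℝ)) : Set (κ → ℂ) := {z | imPart z ∈ U}

/-- The metric `g_M` on `M = ℝ^κ + i U` with Kähler potential `K(z) = -log h(Im z)`. -/
def rMetric (h : (κ → ℝ) → ℝ) : (κ → ℂ) → Matrix (κ ⊕ κ) (κ ⊕ κ) ℝ :=
  kaehlerMetric fun z => -Real.log (h (imPart z))

end RMapConstruction

end

end RMap

namespace RMap

open scoped ContDiff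

set_option linter.unusedSectionVars false

/-! ### Coordinate partial derivatives on an open set -/

section PartialDerivatives

variable {κ : Type*} [Fintype κ] [DecidableEq κ] {U : Set (κ → ℝ)}

/-! The potential depends on `x` alone, so `∂_z ∂_z̄` acts on it as `¼ ∂²` and the metric is `½ (k
dy² + k dx²)` with `k = -∂² log h`. Since `∂k` is totally symmetric, every Christoffel symbol is `0`
or `± γ`, where `γ = ½ k⁻¹ ∂k` (`christoffel_tube`). In the Ricci tensor the terms quadratic in `γ`
cancel. What is left is `-½ ∂² log |det k|` on the `yy` and `xx` blocks and `0` on the mixed ones,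
the real form of `Ric = -∂∂̄ log |det k|`.

The rest is homogeneity. Euler's identities `dh(x) = D h` and `∂²h x = (D - 1) dh` split space into
`ℝx` and `ker dh`, orthogonally for `∂²h`; this gives `d ≠ 0` and `k > 0`. Moreover `k = -∂²h / h +
dh dhᵀ / h²` is a rank-one perturbation, so `det k` is a constant times `d / h^m` (`det_logMetric`),
and `k⁻¹ = h (-∂²h)⁻¹ + x xᵀ / (D - 1)` (`logMetric_inv`).

Tracing `∂² log |d| + m k` with `k⁻¹` gives the scalar curvature: `m k` contributes `m²`, the first
part of `k⁻¹` the terms in `d`, and the second, by Euler's identity for `d` of degree `m (D - 2)`,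
the term `-m (D - 2) / (D - 1)`. -/

theorem partialDeriv_congr (hU : IsOpen U) {f g : (κ → ℝ) → ℝ} (hfg : ∀ y ∈ U, f y = g y)
    {x : κ → ℝ} (hx : x ∈ U) (μ : κ) : partialDeriv μ f x = partialDeriv μ g x := by
  unfold partialDeriv
  rw [Filter.EventuallyEq.fderiv_eq (Filter.eventually_of_mem (hU.mem_nhds hx) hfg)]

theorem contDiffOn_partialDeriv (hU : IsOpen U) {f : (κ → ℝ) → ℝ} (hf : ContDiffOn ℝ ∞ f U)
    (μ : κ) : ContDiffOn ℝ ∞ (partialDeriv μ f) U :=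
  (hf.fderiv_of_isOpen hU (by simp)).clm_apply contDiffOn_const

theorem differentiableAt_of_smooth (hU : IsOpen U) {f : (κ → ℝ) → ℝ} (hf : ContDiffOn ℝ ∞ f U)
    {x : κ → ℝ} (hx : x ∈ U) : DifferentiableAt ℝ f x :=
  (hf.contDiffAt (hU.mem_nhds hx)).differentiableAt (by simp)

theorem partialDeriv_const (c : ℝ) (x : κ → ℝ) (μ : κ) : partialDeriv μ (fun _ => c) x = 0 := by
  simp [partialDeriv]

theorem partialDeriv_neg (f : (κ → ℝ) → ℝ) (x : κ → ℝ) (μ : κ) :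
    partialDeriv μ (fun y => -f y) x = -partialDeriv μ f x := by
  simp [partialDeriv, fderiv_fun_neg]

theorem partialDeriv_add {f g : (κ → ℝ) → ℝ} {x : κ → ℝ} (hf : DifferentiableAt ℝ f x)
    (hg : DifferentiableAt ℝ g x) (μ : κ) :
    partialDeriv μ (fun y => f y + g y) x = partialDeriv μ f x + partialDeriv μ g x := by
  simp [partialDeriv, fderiv_fun_add hf hg]

theorem partialDeriv_mul {f g : (κ → ℝ) → ℝ} {x : κ → ℝ} (hf : DifferentiableAt ℝ f x)
    (hg : DifferentiableAt ℝ g x) (μ : κ) :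
    partialDeriv μ (fun y => f y * g y) x
      = partialDeriv μ f x * g x + f x * partialDeriv μ g x := by
  simp [partialDeriv, fderiv_fun_mul hf hg]
  ring

theorem partialDeriv_const_mul {f : (κ → ℝ) → ℝ} {x : κ → ℝ} (hf : DifferentiableAt ℝ f x)
    (c : ℝ) (μ : κ) : partialDeriv μ (fun y => c * f y) x = c * partialDeriv μ f x := by
  simp [partialDeriv, fderiv_const_mul hf]

theorem partialDeriv_sum {ι : Type*} (s : Finset ι) {f : ι → (κ → ℝ) → ℝ} {x : κ → ℝ}
    (hf : ∀ i ∈ s, DifferentiableAt ℝ (f i) x) (μ : κ) :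
    partialDeriv μ (fun y => ∑ i ∈ s, f i y) x = ∑ i ∈ s, partialDeriv μ (f i) x := by
  simp [partialDeriv, fderiv_fun_sum hf]

theorem partialDeriv_log {f : (κ → ℝ) → ℝ} {x : κ → ℝ} (hf : DifferentiableAt ℝ f x)
    (h0 : f x ≠ 0) (μ : κ) :
    partialDeriv μ (fun y => Real.log (f y)) x = partialDeriv μ f x / f x := by
  simp [partialDeriv, fderiv.log hf h0, div_eq_inv_mul]

theorem partialDeriv_inv {f : (κ → ℝ) → ℝ} {x : κ → ℝ} (hf : DifferentiableAt ℝ f x)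
    (h0 : f x ≠ 0) (μ : κ) :
    partialDeriv μ (fun y => (f y)⁻¹) x = -partialDeriv μ f x / f x ^ 2 := by
  have := ((hasDerivAt_inv h0).comp_hasFDerivAt x hf.hasFDerivAt).fderiv
  simp only [partialDeriv]
  erw [this]
  simp [div_eq_inv_mul]

/-- Schwarz's theorem. Applied to first derivatives of `-log h`, it also yields the total symmetry
of `∂k`. -/
theorem partialDeriv_comm (hU : IsOpen U) {f : (κ → ℝ) → ℝ} (hf : ContDiffOn ℝ ∞ f U)
    {x : κ → ℝ} (hx : x ∈ U) (μ ν : κ) :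
    partialDeriv μ (partialDeriv ν f) x = partialDeriv ν (partialDeriv μ f) x := by
  have hc := hf.contDiffAt (hU.mem_nhds hx)
  have hs : IsSymmSndFDerivAt ℝ f x := hc.isSymmSndFDerivAt (by
    rw [minSmoothness_of_isRCLikeNormedField]
    exact WithTop.coe_le_coe.2 le_top)
  have hd : DifferentiableAt ℝ (fderiv ℝ f) x :=
    ((hf.fderiv_of_isOpen hU (m := ∞) (by simp)).contDiffAt (hU.mem_nhds hx)).differentiableAt
      (by simp)
  have key : ∀ a b : κ, partialDeriv a (partialDeriv b f) x
      = fderiv ℝ (fderiv ℝ f) x (Pi.single a 1) (Pi.single b 1) := fun a b => by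
    change fderiv ℝ (fun y => fderiv ℝ f y (Pi.single b 1)) x _ = _
    rw [fderiv_clm_apply hd (differentiableAt_const _)]
    simp
  rw [key, key]
  exact hs _ _

theorem fderiv_eq_sum_partialDeriv (f : (κ → ℝ) → ℝ) (x v : κ → ℝ) :
    fderiv ℝ f x v = ∑ μ, v μ * partialDeriv μ f x := by
  conv_lhs => rw [pi_eq_sum_univ' v]
  simp [partialDeriv, map_sum]

theorem hessian_log (hU : IsOpen U) {f : (κ → ℝ) → ℝ} (hf : ContDiffOn ℝ ∞ f U)
    (h0 : ∀ y ∈ U, f y ≠ 0) {x : κ → ℝ} (hx : x ∈ U) (μ ν : κ) :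
    hessian (fun y => Real.log (f y)) x μ ν
      = hessian f x μ ν / f x - partialDeriv μ f x * partialDeriv ν f x / f x ^ 2 := by
  have hd := differentiableAt_of_smooth hU hf hx
  have hp := differentiableAt_of_smooth hU (contDiffOn_partialDeriv hU hf ν) hx
  have hi : DifferentiableAt ℝ (fun y => (f y)⁻¹) x := hd.inv (h0 x hx)
  change partialDeriv μ (partialDeriv ν fun y => Real.log (f y)) x
    = partialDeriv μ (partialDeriv ν f) x / f x - _
  rw [partialDeriv_congr hU (g := fun y => partialDeriv ν f y * (f y)⁻¹)
    (fun y hy => by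
      rw [partialDeriv_log (differentiableAt_of_smooth hU hf hy) (h0 y hy), div_eq_mul_inv]) hx,
    partialDeriv_mul hp hi, partialDeriv_inv hd (h0 x hx)]
  ring

end PartialDerivatives

/-! ### Derivatives of inverses and determinants -/

section MatrixFunctions

variable {κ : Type*} [Fintype κ] [DecidableEq κ] {U : Set (κ → ℝ)}
variable {ι : Type*} [Fintype ι] [DecidableEq ι]

theorem contDiffOn_det {k : (κ → ℝ) → Matrix ι ι ℝ}
    (hk : ∀ a b, ContDiffOn ℝ ∞ (fun y => k y a b) U) :
    ContDiffOn ℝ ∞ (fun y => (k y).det) U := by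
  simp only [Matrix.det_apply']
  exact ContDiffOn.sum fun σ _ => contDiffOn_const.mul (contDiffOn_prod fun i _ => hk _ _)

/-- Cramer's rule: an entry of the inverse is a minor, written as the determinant with row `b`
replaced by a constant basis vector, divided by the determinant. -/
theorem contDiffOn_inv_apply {k : (κ → ℝ) → Matrix ι ι ℝ}
    (hk : ∀ a b, ContDiffOn ℝ ∞ (fun y => k y a b) U) (h0 : ∀ y ∈ U, (k y).det ≠ 0) (a b : ι) :
    ContDiffOn ℝ ∞ (fun y => (k y)⁻¹ a b) U := by
  simp only [Matrix.inv_def, Matrix.smul_apply, smul_eq_mul, Ring.inverse_eq_inv',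
    Matrix.adjugate_apply]
  refine ((contDiffOn_det hk).inv h0).mul (contDiffOn_det fun i j => ?_)
  by_cases hi : i = b
  · subst hi
    simpa using contDiffOn_const
  · simpa [Matrix.updateRow_ne hi] using hk i j

/-- The derivative of the inverse: `∂(k⁻¹) = -k⁻¹ (∂k) k⁻¹`. -/
theorem partialDeriv_inv_apply (hU : IsOpen U) {k : (κ → ℝ) → Matrix ι ι ℝ}
    (hk : ∀ a b, ContDiffOn ℝ ∞ (fun y => k y a b) U) (h0 : ∀ y ∈ U, (k y).det ≠ 0)
    {x : κ → ℝ} (hx : x ∈ U) (μ : κ) (a b : ι) :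
    partialDeriv μ (fun y => (k y)⁻¹ a b) x
      = -∑ p, ∑ q, (k x)⁻¹ a p * partialDeriv μ (fun y => k y p q) x * (k x)⁻¹ q b := by
  have hu : ∀ y ∈ U, IsUnit (k y).det := fun y hy => (h0 y hy).isUnit
  obtain ⟨dk, hdk⟩ : ∃ dk : Matrix ι ι ℝ, ∀ p q, dk p q = partialDeriv μ (fun y => k y p q) x :=
    ⟨Matrix.of fun p q => partialDeriv μ (fun y => k y p q) x, fun _ _ => rfl⟩
  obtain ⟨di, hdi⟩ : ∃ di : Matrix ι ι ℝ,
      ∀ p q, di p q = partialDeriv μ (fun y => (k y)⁻¹ p q) x :=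
    ⟨Matrix.of fun p q => partialDeriv μ (fun y => (k y)⁻¹ p q) x, fun _ _ => rfl⟩
  have hd : ∀ p q, DifferentiableAt ℝ (fun y => k y p q) x :=
    fun p q => differentiableAt_of_smooth hU (hk p q) hx
  have hi : ∀ p q, DifferentiableAt ℝ (fun y => (k y)⁻¹ p q) x :=
    fun p q => differentiableAt_of_smooth hU (contDiffOn_inv_apply hk h0 p q) hx
  -- Differentiate `k⁻¹ k = 1` entrywise.
  have key : di * k x + (k x)⁻¹ * dk = 0 := by
    ext p q
    have h1 : partialDeriv μ (fun y => ∑ l, (k y)⁻¹ p l * k y l q) x = 0 := by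
      rw [partialDeriv_congr hU (g := fun _ => (1 : Matrix ι ι ℝ) p q) (fun y hy => by
        rw [← Matrix.mul_apply, Matrix.nonsing_inv_mul _ (hu y hy)]) hx, partialDeriv_const]
    rw [partialDeriv_sum (f := fun l y => (k y)⁻¹ p l * k y l q) _
      fun l _ => (hi p l).mul (hd l q)] at h1
    simp only [Matrix.add_apply, Matrix.mul_apply, Matrix.zero_apply, ← Finset.sum_add_distrib]
    rw [← h1]
    refine Finset.sum_congr rfl fun l _ => ?_
    rw [partialDeriv_mul (hi p l) (hd l q), hdi, hdk]
  have h2 : di = -((k x)⁻¹ * dk * (k x)⁻¹) := by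
    calc di = di * k x * (k x)⁻¹ := by rw [Matrix.mul_nonsing_inv_cancel_right _ _ (hu x hx)]
      _ = _ := by rw [eq_neg_of_add_eq_zero_left key, Matrix.neg_mul]
  have h3 := congrFun (congrFun h2 a) b
  simp only [hdi, Matrix.neg_apply, Matrix.mul_apply, hdk] at h3
  rw [h3, Finset.sum_comm]
  simp [Finset.sum_mul]

/-- **Jacobi's formula** for the derivative of a determinant. -/
theorem partialDeriv_det (hU : IsOpen U) {k : (κ → ℝ) → Matrix ι ι ℝ}
    (hk : ∀ a b, ContDiffOn ℝ ∞ (fun y => k y a b) U) (h0 : ∀ y ∈ U, (k y).det ≠ 0)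
    {x : κ → ℝ} (hx : x ∈ U) (μ : κ) :
    partialDeriv μ (fun y => (k y).det) x
      = (k x).det * ∑ a, ∑ b, (k x)⁻¹ a b * partialDeriv μ (fun y => k y b a) x := by
  obtain ⟨dk, hdk⟩ : ∃ dk : Matrix ι ι ℝ, ∀ p q, dk p q = partialDeriv μ (fun y => k y p q) x :=
    ⟨Matrix.of fun p q => partialDeriv μ (fun y => k y p q) x, fun _ _ => rfl⟩
  have hd : ∀ a b, DifferentiableAt ℝ (fun y => k y a b) x :=
    fun a b => differentiableAt_of_smooth hU (hk a b) hx
  -- Product rule in the Leibniz expansion, one row at a time. The expansion is transposed so that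
  -- the product runs over rows.
  have h1 : partialDeriv μ (fun y => (k y).det) x
      = ∑ b, ((k x).updateRow b (dk b)).det := by
    have e : ∀ y, (k y).det = ∑ σ : Equiv.Perm ι, ((Equiv.Perm.sign σ : ℤ) : ℝ) *
        ∏ i, k y i (σ i) := fun y => by
      rw [← Matrix.det_transpose, Matrix.det_apply']; rfl
    simp only [e]
    have hp : ∀ σ : Equiv.Perm ι, HasFDerivAt (fun y => ∏ i, k y i (σ i))
      (∑ i, (∏ j ∈ Finset.univ.erase i, k x j (σ j)) • fderiv ℝ (fun y => k y i (σ i)) x) x :=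
      fun σ => HasFDerivAt.finsetProd fun i _ => (hd i (σ i)).hasFDerivAt
    rw [partialDeriv_sum _ fun σ _ => (hp σ).differentiableAt.const_mul _]
    simp only [partialDeriv_const_mul (hp _).differentiableAt]
    simp only [← Matrix.det_transpose (Matrix.updateRow _ _ _), Matrix.det_apply']
    rw [Finset.sum_comm]
    refine Finset.sum_congr rfl fun σ _ => ?_
    rw [← Finset.mul_sum]
    congr 1
    unfold partialDeriv
    rw [(hp σ).fderiv]
    simp only [sum_apply, smul_apply, smul_eq_mul]
    refine Finset.sum_congr rfl fun b _ => ?_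
    rw [← Finset.prod_erase_mul _ _ (Finset.mem_univ b)]
    congr 1
    · refine Finset.prod_congr rfl fun j hj => ?_
      simp [Matrix.updateRow_ne (Finset.ne_of_mem_erase hj)]
    · simp [hdk, partialDeriv]
  -- Expansion along the replaced row, with cofactors read off from the adjugate `det k • k⁻¹`.
  have h2 : ∀ b, ((k x).updateRow b (dk b)).det
      = (k x).det * ∑ a, (k x)⁻¹ a b * dk b a := fun b => by
    rw [← Matrix.cramer_transpose_apply, Matrix.cramer_eq_adjugate_mulVec,
      ← Matrix.adjugate_transpose, Matrix.mulVec, dotProduct, Finset.mul_sum]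
    refine Finset.sum_congr rfl fun a _ => ?_
    rw [Matrix.inv_def]
    simp only [Matrix.transpose_apply, Matrix.smul_apply, smul_eq_mul, Ring.inverse_eq_inv']
    field_simp [h0 x hx]
  rw [h1, Finset.sum_comm, Finset.mul_sum]
  exact Finset.sum_congr rfl fun b _ => by simp only [h2, hdk]

end MatrixFunctions

/-! ### Metrics on a tube that depend on the imaginary part only -/

section TubeMetrics

variable {κ : Type*} [Fintype κ] [DecidableEq κ] {U : Set (κ → ℝ)}

/-- The imaginary part as a continuous linear map. -/
noncomputable def imPartCLM (κ : Type*) [Fintype κ] : (κ → ℂ) →L[ℝ] (κ → ℝ) :=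
  ContinuousLinearMap.pi fun μ => Complex.imCLM ∘L ContinuousLinearMap.proj μ

theorem imPart_single (μ : κ) (c : ℂ) : imPart (Pi.single μ c) = Pi.single μ c.im := by
  ext ν
  by_cases hν : ν = μ
  · subst hν; simp [imPart]
  · simp [imPart, hν]

theorem isOpen_tube (hU : IsOpen U) : IsOpen (tube U) :=
  hU.preimage (imPartCLM κ).continuous

theorem fderiv_comp_imPart {E : Type*} [NormedAddCommGroup E] [NormedSpace ℝ E]
    {f : (κ → ℝ) → E} {z : κ → ℂ} (hf : DifferentiableAt ℝ f (imPart z)) (v : κ → ℂ) :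
    fderiv ℝ (fun w => f (imPart w)) z v = fderiv ℝ f (imPart z) (imPart v) := by
  have h1 : HasFDerivAt (fun w => f (imPart w)) (fderiv ℝ f (imPart z) ∘L imPartCLM κ) z :=
    HasFDerivAt.comp z (f := imPart) hf.hasFDerivAt (imPartCLM κ).hasFDerivAt
  rw [h1.fderiv]
  rfl

theorem coordDeriv_congr (hU : IsOpen U) {f f' : (κ → ℂ) → ℝ} (hf : ∀ w ∈ tube U, f w = f' w)
    {z : κ → ℂ} (hz : z ∈ tube U) (i : κ ⊕ κ) : coordDeriv i f z = coordDeriv i f' z := by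
  unfold coordDeriv
  rw [Filter.EventuallyEq.fderiv_eq
    (Filter.eventually_of_mem ((isOpen_tube hU).mem_nhds hz) hf)]

theorem coordDeriv_inl (hU : IsOpen U) {f : (κ → ℂ) → ℝ} {F : (κ → ℝ) → ℝ}
    (hF : ContDiffOn ℝ ∞ F U) (hf : ∀ w ∈ tube U, f w = F (imPart w)) {z : κ → ℂ}
    (hz : z ∈ tube U) (μ : κ) : coordDeriv (Sum.inl μ) f z = 0 := by
  rw [coordDeriv_congr hU hf hz]
  unfold coordDeriv
  rw [fderiv_comp_imPart (differentiableAt_of_smooth hU hF hz)]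
  simp [coordVec, imPart_single]

theorem coordDeriv_inr (hU : IsOpen U) {f : (κ → ℂ) → ℝ} {F : (κ → ℝ) → ℝ}
    (hF : ContDiffOn ℝ ∞ F U) (hf : ∀ w ∈ tube U, f w = F (imPart w)) {z : κ → ℂ}
    (hz : z ∈ tube U) (μ : κ) :
    coordDeriv (Sum.inr μ) f z = partialDeriv μ F (imPart z) := by
  rw [coordDeriv_congr hU hf hz]
  unfold coordDeriv
  rw [fderiv_comp_imPart (differentiableAt_of_smooth hU hF hz)]
  simp [coordVec, imPart_single, partialDeriv]

/-- A smooth nondegenerate symmetric matrix function `k` whose derivative is totally symmetric,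
i.e. a (possibly indefinite) Hessian metric. -/
structure IsHessianMetric (U : Set (κ → ℝ)) (k : (κ → ℝ) → Matrix κ κ ℝ) : Prop where
  isOpen : IsOpen U
  smooth : ∀ a b, ContDiffOn ℝ ∞ (fun y => k y a b) U
  symm : ∀ x ∈ U, (k x).IsSymm
  deriv_symm : ∀ x ∈ U, ∀ a b c,
    partialDeriv a (fun y => k y b c) x = partialDeriv b (fun y => k y a c) x
  det_ne_zero : ∀ x ∈ U, (k x).det ≠ 0

/-- The Christoffel symbols `γ^c_{ab}` of a Hessian metric. -/
noncomputable def connCoeff (k : (κ → ℝ) → Matrix κ κ ℝ) (c a b : κ) (x : κ → ℝ) : ℝ :=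
  (1 / 2) * ∑ l, (k x)⁻¹ c l * partialDeriv a (fun y => k y b l) x

/-- The Christoffel symbols of the metric `½ (k dy² + k dx²)` on the tube `ℝ^κ + i U`. -/
noncomputable def tubeConnCoeff (k : (κ → ℝ) → Matrix κ κ ℝ) :
    κ ⊕ κ → κ ⊕ κ → κ ⊕ κ → (κ → ℝ) → ℝ
  | Sum.inr c, Sum.inr a, Sum.inr b => connCoeff k c a b
  | Sum.inr c, Sum.inl a, Sum.inl b => fun x => -connCoeff k c a b x
  | Sum.inl c, Sum.inr a, Sum.inl b => connCoeff k c a b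
  | Sum.inl c, Sum.inl a, Sum.inr b => connCoeff k c a b
  | Sum.inr _, Sum.inr _, Sum.inl _ => fun _ => 0
  | Sum.inr _, Sum.inl _, Sum.inr _ => fun _ => 0
  | Sum.inl _, Sum.inr _, Sum.inr _ => fun _ => 0
  | Sum.inl _, Sum.inl _, Sum.inl _ => fun _ => 0

/-! ### Christoffel symbols of a Hessian metric -/

namespace IsHessianMetric

variable {k : (κ → ℝ) → Matrix κ κ ℝ}

theorem deriv_swap (hk : IsHessianMetric U k) {x : κ → ℝ} (hx : x ∈ U) (a b c : κ) :
    partialDeriv a (fun y => k y b c) x = partialDeriv a (fun y => k y c b) x :=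
  partialDeriv_congr hk.isOpen (fun y hy => (hk.symm y hy).apply c b) hx a

theorem smooth_inv (hk : IsHessianMetric U k) (a b : κ) :
    ContDiffOn ℝ ∞ (fun y => (k y)⁻¹ a b) U :=
  contDiffOn_inv_apply hk.smooth hk.det_ne_zero a b

theorem smooth_deriv (hk : IsHessianMetric U k) (a b c : κ) :
    ContDiffOn ℝ ∞ (partialDeriv a fun y => k y b c) U :=
  contDiffOn_partialDeriv hk.isOpen (hk.smooth b c) a

theorem smooth_connCoeff (hk : IsHessianMetric U k) (c a b : κ) :
    ContDiffOn ℝ ∞ (connCoeff k c a b) U :=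
  contDiffOn_const.mul
    (ContDiffOn.sum fun l _ => (hk.smooth_inv c l).mul (hk.smooth_deriv a b l))

theorem smooth_tubeConnCoeff (hk : IsHessianMetric U k) (i j l : κ ⊕ κ) :
    ContDiffOn ℝ ∞ (tubeConnCoeff k i j l) U := by
  rcases i with c | c <;> rcases j with a | a <;> rcases l with b | b <;>
  first
  | exact hk.smooth_connCoeff c a b
  | exact (hk.smooth_connCoeff c a b).neg
  | exact contDiffOn_const

/-- The contraction `γ^c_{ca}` is half the logarithmic derivative of the determinant. -/
theorem connCoeff_trace (hk : IsHessianMetric U k) {x : κ → ℝ} (hx : x ∈ U) (a : κ) :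
    ∑ c, connCoeff k c c a x
      = (1 / 2) * partialDeriv a (fun y => Real.log (k y).det) x := by
  rw [partialDeriv_log (differentiableAt_of_smooth hk.isOpen (contDiffOn_det hk.smooth) hx)
      (hk.det_ne_zero x hx),
    partialDeriv_det hk.isOpen hk.smooth hk.det_ne_zero hx,
    mul_div_cancel_left₀ _ (hk.det_ne_zero x hx)]
  unfold connCoeff
  rw [← Finset.mul_sum]
  congr 1
  refine Finset.sum_congr rfl fun c _ => Finset.sum_congr rfl fun l _ => ?_
  -- Total symmetry moves the free index `a` onto the derivative, as in Jacobi's formula.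
  rw [hk.deriv_symm x hx c a l, hk.deriv_swap hx a c l]

/-- Product rule with `∂(k⁻¹) = -k⁻¹ (∂k) k⁻¹`. Both `k⁻¹ ∂_μ k` and `k⁻¹ ∂_a k` equal `2γ`, so the
prefactor `½` leaves `-2 γγ`. -/
theorem partialDeriv_connCoeff (hk : IsHessianMetric U k) {x : κ → ℝ} (hx : x ∈ U)
    (μ c a b : κ) :
    partialDeriv μ (connCoeff k c a b) x
      = -2 * ∑ q, connCoeff k c μ q x * connCoeff k q a b x
        + (1 / 2) * ∑ l, (k x)⁻¹ c l
          * partialDeriv μ (partialDeriv a fun y => k y b l) x := by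
  have hi : ∀ p q, DifferentiableAt ℝ (fun y => (k y)⁻¹ p q) x :=
    fun p q => differentiableAt_of_smooth hk.isOpen (hk.smooth_inv p q) hx
  have hd : ∀ l, DifferentiableAt ℝ (partialDeriv a fun y => k y b l) x :=
    fun l => differentiableAt_of_smooth hk.isOpen (hk.smooth_deriv a b l) hx
  have hm : ∀ l, DifferentiableAt ℝ
      (fun y => (k y)⁻¹ c l * partialDeriv a (fun y => k y b l) y) x :=
    fun l => (hi c l).mul (hd l)
  have hs : DifferentiableAt ℝ
      (fun y => ∑ l, (k y)⁻¹ c l * partialDeriv a (fun y => k y b l) y) x :=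
    DifferentiableAt.fun_sum fun l _ => hm l
  change partialDeriv μ
    (fun y => (1 / 2) * ∑ l, (k y)⁻¹ c l * partialDeriv a (fun y => k y b l) y) x = _
  rw [partialDeriv_const_mul hs,
    partialDeriv_sum (f := fun l y => (k y)⁻¹ c l * partialDeriv a (fun y => k y b l) y) _
      fun l _ => hm l]
  simp only [partialDeriv_mul (hi c _) (hd _), Finset.sum_add_distrib, mul_add]
  congr 1
  have alg : ∀ (A T : κ → ℝ) (M B : κ → κ → ℝ),
      ∑ l, (∑ p, ∑ q, A p * M p q * B q l) * T l
        = ∑ q, (∑ p, A p * M p q) * ∑ l, B q l * T l := fun A T M B => by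
    simp_rw [Finset.mul_sum]
    rw [Finset.sum_comm]
    refine Finset.sum_congr rfl fun l _ => ?_
    rw [Finset.sum_comm, Finset.sum_mul]
    refine Finset.sum_congr rfl fun q _ => ?_
    rw [← Finset.sum_mul, mul_assoc]
  simp only [partialDeriv_inv_apply hk.isOpen hk.smooth hk.det_ne_zero hx, connCoeff,
    neg_mul, Finset.sum_neg_distrib, mul_neg, neg_inj]
  refine (congrArg (1 / 2 * ·) (alg (fun p => (k x)⁻¹ c p)
    (fun l => partialDeriv a (fun y => k y b l) x)
    (fun p q => partialDeriv μ (fun y => k y p q) x) fun q l => (k x)⁻¹ q l)).trans ?_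
  rw [Finset.mul_sum, Finset.mul_sum]
  refine Finset.sum_congr rfl fun q _ => ?_
  simp only [hk.deriv_swap hx μ _ q]
  ring

/-- The contracted derivative of the Christoffel symbols. -/
theorem partialDeriv_connCoeff_trace (hk : IsHessianMetric U k) {x : κ → ℝ} (hx : x ∈ U)
    (b c : κ) :
    ∑ a, partialDeriv a (connCoeff k a b c) x
      = ∑ a, partialDeriv b (connCoeff k a a c) x
        + 2 * ∑ a, ∑ q, connCoeff k a b q x * connCoeff k q a c x
        - 2 * ∑ a, ∑ q, connCoeff k a a q x * connCoeff k q b c x := by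
  -- The second derivatives of `k` agree on the two sides, so only terms quadratic in `γ` remain.
  have h4 : ∀ a l, partialDeriv a (partialDeriv b fun y => k y c l) x
      = partialDeriv b (partialDeriv a fun y => k y c l) x := fun a l =>
    partialDeriv_comm hk.isOpen (hk.smooth c l) hx a b
  simp only [hk.partialDeriv_connCoeff hx, Finset.sum_add_distrib, ← Finset.mul_sum, h4]
  ring

end IsHessianMetric

/-! ### Christoffel symbols and Ricci tensor of the tube metric -/

variable {k : (κ → ℝ) → Matrix κ κ ℝ} {g : (κ → ℂ) → Matrix (κ ⊕ κ) (κ ⊕ κ) ℝ}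

theorem inv_smul_fromBlocks_diag {A : Matrix κ κ ℝ} (hA : A.det ≠ 0) :
    ((1 / 2 : ℝ) • Matrix.fromBlocks A 0 0 A)⁻¹
      = (2 : ℝ) • Matrix.fromBlocks A⁻¹ 0 0 A⁻¹ := by
  refine Matrix.inv_eq_right_inv ?_
  rw [Matrix.smul_mul, Matrix.mul_smul, Matrix.fromBlocks_multiply, smul_smul]
  simp [Matrix.mul_nonsing_inv _ hA.isUnit]

/-- All `y`-derivatives and off-diagonal blocks vanish, and the total symmetry of `∂k` makes the
surviving terms of the Levi-Civita formula equal up to sign. The factor `½` of the metric cancels in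
`g⁻¹ ∂g`. -/
theorem christoffel_tube (hk : IsHessianMetric U k)
    (hg : ∀ z ∈ tube U, g z = (1 / 2 : ℝ) • Matrix.fromBlocks (k (imPart z)) 0 0 (k (imPart z)))
    {z : κ → ℂ} (hz : z ∈ tube U) (i j l : κ ⊕ κ) :
    christoffel g i j l z = tubeConnCoeff k i j l (imPart z) := by
  have hsm : ∀ a b, ContDiffOn ℝ ∞ (fun y => (1 / 2) * k y a b) U :=
    fun a b => contDiffOn_const.mul (hk.smooth a b)
  have hd : ∀ a b, DifferentiableAt ℝ (fun y => k y a b) (imPart z) :=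
    fun a b => differentiableAt_of_smooth hk.isOpen (hk.smooth a b) hz
  have hll : ∀ a b c, coordDeriv (Sum.inl c) (fun w => g w (Sum.inl a) (Sum.inl b)) z = 0 :=
    fun a b c => coordDeriv_inl hk.isOpen (hsm a b) (fun w hw => by simp [hg w hw]) hz c
  have hlr : ∀ a b i, coordDeriv i (fun w => g w (Sum.inl a) (Sum.inr b)) z = 0 := by
    rintro a b (c | c)
    · exact coordDeriv_inl hk.isOpen contDiffOn_const (F := fun _ => 0)
        (fun w hw => by simp [hg w hw]) hz c
    · rw [coordDeriv_inr hk.isOpen contDiffOn_const (F := fun _ => 0)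
        (fun w hw => by simp [hg w hw]) hz c, partialDeriv_const]
  have hrl : ∀ a b i, coordDeriv i (fun w => g w (Sum.inr a) (Sum.inl b)) z = 0 := by
    rintro a b (c | c)
    · exact coordDeriv_inl hk.isOpen contDiffOn_const (F := fun _ => 0)
        (fun w hw => by simp [hg w hw]) hz c
    · rw [coordDeriv_inr hk.isOpen contDiffOn_const (F := fun _ => 0)
        (fun w hw => by simp [hg w hw]) hz c, partialDeriv_const]
  have hrr : ∀ a b c, coordDeriv (Sum.inl c) (fun w => g w (Sum.inr a) (Sum.inr b)) z = 0 :=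
    fun a b c => coordDeriv_inl hk.isOpen (hsm a b) (fun w hw => by simp [hg w hw]) hz c
  have hll' : ∀ a b c, coordDeriv (Sum.inr c) (fun w => g w (Sum.inl a) (Sum.inl b)) z
      = (1 / 2) * partialDeriv c (fun y => k y a b) (imPart z) := fun a b c => by
    rw [coordDeriv_inr hk.isOpen (hsm a b) (fun w hw => by simp [hg w hw]) hz c,
      partialDeriv_const_mul (hd a b)]
  have hrr' : ∀ a b c, coordDeriv (Sum.inr c) (fun w => g w (Sum.inr a) (Sum.inr b)) z
      = (1 / 2) * partialDeriv c (fun y => k y a b) (imPart z) := fun a b c => by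
    rw [coordDeriv_inr hk.isOpen (hsm a b) (fun w hw => by simp [hg w hw]) hz c,
      partialDeriv_const_mul (hd a b)]
  have h1 : ∀ a b c, partialDeriv a (fun y => k y b c) (imPart z)
      = partialDeriv b (fun y => k y a c) (imPart z) := hk.deriv_symm _ hz
  have h2 : ∀ a b c, partialDeriv a (fun y => k y b c) (imPart z)
      = partialDeriv a (fun y => k y c b) (imPart z) := hk.deriv_swap hz
  unfold christoffel
  rw [hg z hz, inv_smul_fromBlocks_diag (hk.det_ne_zero _ hz)]
  rcases i with c | c <;> rcases j with a | a <;> rcases l with b | b <;>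
    simp only [Fintype.sum_sum_type, hll, hlr, hrl, hrr, hll', hrr', tubeConnCoeff, connCoeff,
      Matrix.smul_apply, Matrix.fromBlocks_apply₁₁, Matrix.fromBlocks_apply₁₂,
      Matrix.fromBlocks_apply₂₁, Matrix.fromBlocks_apply₂₂, Matrix.zero_apply,
      zero_mul, mul_zero, Finset.sum_const_zero, add_zero, zero_add, sub_zero,
      smul_eq_mul,
      Finset.mul_sum, ← Finset.sum_neg_distrib]
  · refine Finset.sum_congr rfl fun l _ => ?_
    rw [h1 b a l]; ring
  · exact Finset.sum_congr rfl fun l _ => by ring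
  · refine Finset.sum_congr rfl fun l _ => ?_
    rw [h1 l a b, h2 a l b]; ring
  · refine Finset.sum_congr rfl fun l _ => ?_
    rw [h1 b a l, h1 l a b, h2 a l b]; ring

theorem coordDeriv_inl_christoffel_tube (hk : IsHessianMetric U k)
    (hg : ∀ z ∈ tube U, g z = (1 / 2 : ℝ) • Matrix.fromBlocks (k (imPart z)) 0 0 (k (imPart z)))
    {z : κ → ℂ} (hz : z ∈ tube U) (μ : κ) (i j l : κ ⊕ κ) :
    coordDeriv (Sum.inl μ) (christoffel g i j l) z = 0 :=
  coordDeriv_inl hk.isOpen (hk.smooth_tubeConnCoeff i j l)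
    (fun _ hw => christoffel_tube hk hg hw i j l) hz μ

theorem coordDeriv_inr_christoffel_tube (hk : IsHessianMetric U k)
    (hg : ∀ z ∈ tube U, g z = (1 / 2 : ℝ) • Matrix.fromBlocks (k (imPart z)) 0 0 (k (imPart z)))
    {z : κ → ℂ} (hz : z ∈ tube U) (μ : κ) (i j l : κ ⊕ κ) :
    coordDeriv (Sum.inr μ) (christoffel g i j l) z
      = partialDeriv μ (tubeConnCoeff k i j l) (imPart z) :=
  coordDeriv_inr hk.isOpen (hk.smooth_tubeConnCoeff i j l)
    (fun _ hw => christoffel_tube hk hg hw i j l) hz μ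

/-- This brings `log det k` into the Ricci tensor: the trace of `γ` is half the gradient of `log det
k`. -/
theorem partialDeriv_connCoeff_trace_eq_hessian (hk : IsHessianMetric U k) {x : κ → ℝ}
    (hx : x ∈ U) (a b : κ) :
    ∑ c, partialDeriv a (connCoeff k c c b) x
      = (1 / 2) * hessian (fun y => Real.log (k y).det) x a b := by
  have hs : ContDiffOn ℝ ∞ (fun y => Real.log (k y).det) U :=
    (contDiffOn_det hk.smooth).log hk.det_ne_zero
  rw [← partialDeriv_sum (f := fun c => connCoeff k c c b) _ fun c _ =>
      differentiableAt_of_smooth hk.isOpen (hk.smooth_connCoeff c c b) hx,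
    partialDeriv_congr hk.isOpen (fun y hy => hk.connCoeff_trace hy b) hx,
    partialDeriv_const_mul
      (differentiableAt_of_smooth hk.isOpen (contDiffOn_partialDeriv hk.isOpen hs b) hx)]
  rfl

/-- The divergence term is `-∑ ∂_c γ^c_{ab}`. Exchanging the derivative and the trace index by
`partialDeriv_connCoeff_trace` produces quadratic terms that cancel those of the curvature, leaving
`-∑ ∂_a γ^c_{cb}`. -/
theorem ricci_tube_inl_inl (hk : IsHessianMetric U k)
    (hg : ∀ z ∈ tube U, g z = (1 / 2 : ℝ) • Matrix.fromBlocks (k (imPart z)) 0 0 (k (imPart z)))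
    {z : κ → ℂ} (hz : z ∈ tube U) (a b : κ) :
    ricci g (Sum.inl a) (Sum.inl b) z
      = -(1 / 2) * hessian (fun y => Real.log (k y).det) (imPart z) a b := by
  have h1 := hk.partialDeriv_connCoeff_trace hz a b
  rw [partialDeriv_connCoeff_trace_eq_hessian hk hz] at h1
  simp only [ricci, riemann, Fintype.sum_sum_type, coordDeriv_inl_christoffel_tube hk hg hz,
    coordDeriv_inr_christoffel_tube hk hg hz, christoffel_tube hk hg hz, tubeConnCoeff,
    partialDeriv_neg, Finset.sum_add_distrib, Finset.sum_sub_distrib, Finset.sum_neg_distrib,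
    mul_neg, neg_mul, mul_zero, Finset.sum_const_zero, h1]
  ring_nf

/-- Here the divergence enters with a plus sign, but `∂_a` meets the full trace `2 ∑ γ^c_{cb}`. The
quadratic terms cancel again, and the net contribution is `(1 - 2) ∑ ∂_a γ^c_{cb}`. -/
theorem ricci_tube_inr_inr (hk : IsHessianMetric U k)
    (hg : ∀ z ∈ tube U, g z = (1 / 2 : ℝ) • Matrix.fromBlocks (k (imPart z)) 0 0 (k (imPart z)))
    {z : κ → ℂ} (hz : z ∈ tube U) (a b : κ) :
    ricci g (Sum.inr a) (Sum.inr b) z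
      = -(1 / 2) * hessian (fun y => Real.log (k y).det) (imPart z) a b := by
  have h1 := hk.partialDeriv_connCoeff_trace hz a b
  have h2 := partialDeriv_connCoeff_trace_eq_hessian hk hz a b
  rw [h2] at h1
  simp only [ricci, riemann, Fintype.sum_sum_type, coordDeriv_inl_christoffel_tube hk hg hz,
    coordDeriv_inr_christoffel_tube hk hg hz, christoffel_tube hk hg hz, tubeConnCoeff,
    Finset.sum_add_distrib, Finset.sum_sub_distrib, neg_mul, mul_zero, Finset.sum_const_zero,
    h1, h2]
  ring_nf

/-- The reflection `y ↦ -y` is the reason: symbols with an odd number of `y`-indices vanish, so each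
term contains such a symbol or a `y`-derivative. -/
theorem ricci_tube_inl_inr (hk : IsHessianMetric U k)
    (hg : ∀ z ∈ tube U, g z = (1 / 2 : ℝ) • Matrix.fromBlocks (k (imPart z)) 0 0 (k (imPart z)))
    {z : κ → ℂ} (hz : z ∈ tube U) (a b : κ) :
    ricci g (Sum.inl a) (Sum.inr b) z = 0 := by
  simp [ricci, riemann, coordDeriv_inl_christoffel_tube hk hg hz,
    coordDeriv_inr_christoffel_tube hk hg hz, christoffel_tube hk hg hz, tubeConnCoeff,
    partialDeriv_const]

theorem ricci_tube_inr_inl (hk : IsHessianMetric U k)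
    (hg : ∀ z ∈ tube U, g z = (1 / 2 : ℝ) • Matrix.fromBlocks (k (imPart z)) 0 0 (k (imPart z)))
    {z : κ → ℂ} (hz : z ∈ tube U) (a b : κ) :
    ricci g (Sum.inr a) (Sum.inl b) z = 0 := by
  simp [ricci, riemann, coordDeriv_inl_christoffel_tube hk hg hz,
    coordDeriv_inr_christoffel_tube hk hg hz, christoffel_tube hk hg hz, tubeConnCoeff,
    partialDeriv_const]

end TubeMetrics

/-! ### Homogeneous functions on a cone -/

section Homogeneous

variable {κ : Type*} [Fintype κ] [DecidableEq κ] {U : Set (κ → ℝ)}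

/-- The function `f` is homogeneous of degree `e` on the cone `U`. -/
def IsHomogeneousOn (e : ℝ) (U : Set (κ → ℝ)) (f : (κ → ℝ) → ℝ) : Prop :=
  ∀ t : ℝ, 0 < t → ∀ x ∈ U, f (t • x) = t ^ e * f x

theorem IsHomogeneousOn.partialDeriv {e : ℝ} {f : (κ → ℝ) → ℝ} (hf : IsHomogeneousOn e U f)
    (hU : IsOpen U) (hcone : ∀ t : ℝ, 0 < t → ∀ x ∈ U, t • x ∈ U) (hs : ContDiffOn ℝ ∞ f U)
    (μ : κ) : IsHomogeneousOn (e - 1) U (partialDeriv μ f) := by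
  intro t ht x hx
  have h1 : HasFDerivAt (fun y : κ → ℝ => f (t • y))
      (fderiv ℝ f (t • x) ∘L (t • ContinuousLinearMap.id ℝ (κ → ℝ))) x :=
    HasFDerivAt.comp x (f := fun y => t • y)
      (differentiableAt_of_smooth hU hs (hcone t ht x hx)).hasFDerivAt
      ((hasFDerivAt_id x).const_smul t)
  have h2 : RMap.partialDeriv μ (fun y => f (t • y)) x = t ^ e * RMap.partialDeriv μ f x := by
    rw [partialDeriv_congr hU (fun y hy => hf t ht y hy) hx,
      partialDeriv_const_mul (differentiableAt_of_smooth hU hs hx)]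
  have h3 : RMap.partialDeriv μ (fun y => f (t • y)) x = t * RMap.partialDeriv μ f (t • x) := by
    simp [RMap.partialDeriv, h1.fderiv]
  rw [Real.rpow_sub_one ht.ne', div_mul_eq_mul_div, eq_div_iff ht.ne', ← h2, h3, mul_comm]

/-- **Euler's identity** for homogeneous functions. -/
theorem IsHomogeneousOn.euler {e : ℝ} {f : (κ → ℝ) → ℝ} (hf : IsHomogeneousOn e U f)
    (hU : IsOpen U) (hs : ContDiffOn ℝ ∞ f U) {x : κ → ℝ} (hx : x ∈ U) :
    ∑ μ, x μ * RMap.partialDeriv μ f x = e * f x := by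
  rw [← fderiv_eq_sum_partialDeriv]
  have h0 : HasDerivAt (fun t : ℝ => t • x) x 1 := by
    simpa using (hasDerivAt_id (1 : ℝ)).smul_const x
  have h1 : HasDerivAt (fun t : ℝ => f (t • x)) (fderiv ℝ f x x) 1 :=
    HasFDerivAt.comp_hasDerivAt (f := fun t : ℝ => t • x) 1
      (by simpa using (differentiableAt_of_smooth hU hs hx).hasFDerivAt) h0
  have h2 : HasDerivAt (fun t : ℝ => t ^ e * f x) (e * f x) 1 := by
    simpa using (Real.hasDerivAt_rpow_const (x := 1) (p := e) (Or.inl one_ne_zero)).mul_const (f x)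
  refine h1.unique (h2.congr_of_eventuallyEq ?_)
  filter_upwards [eventually_gt_nhds (zero_lt_one' ℝ)] with t ht using hf t ht x hx

end Homogeneous

/-! ### Homogeneity of `h` and the metric `-∂² log h` -/

namespace IsDatum

variable {κ : Type*} [Fintype κ] [DecidableEq κ] {U : Set (κ → ℝ)} {D : ℝ} {h : (κ → ℝ) → ℝ}
variable {x : κ → ℝ}

theorem smooth_partialDeriv (hU : IsDatum D U h) (μ : κ) :
    ContDiffOn ℝ ∞ (partialDeriv μ h) U := contDiffOn_partialDeriv hU.isOpen hU.smooth μ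

theorem smooth_hessian (hU : IsDatum D U h) (μ ν : κ) :
    ContDiffOn ℝ ∞ (fun y => hessian h y μ ν) U :=
  contDiffOn_partialDeriv hU.isOpen (hU.smooth_partialDeriv ν) μ

theorem smooth_hessianDet (hU : IsDatum D U h) : ContDiffOn ℝ ∞ (hessianDet h) U :=
  contDiffOn_det hU.smooth_hessian

theorem homogeneous_partialDeriv (hU : IsDatum D U h) (μ : κ) :
    IsHomogeneousOn (D - 1) U (partialDeriv μ h) :=
  IsHomogeneousOn.partialDeriv hU.homogeneous hU.isOpen hU.smul_mem hU.smooth μ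

theorem homogeneous_hessian (hU : IsDatum D U h) (μ ν : κ) :
    IsHomogeneousOn (D - 2) U (fun y => hessian h y μ ν) := by
  have h1 := (hU.homogeneous_partialDeriv ν).partialDeriv hU.isOpen hU.smul_mem
    (hU.smooth_partialDeriv ν) μ
  rwa [show D - 1 - 1 = D - 2 by ring] at h1

theorem homogeneous_hessianDet (hU : IsDatum D U h) :
    IsHomogeneousOn (Fintype.card κ * (D - 2)) U (hessianDet h) := by
  intro t ht x hx
  have h1 : hessian h (t • x) = t ^ (D - 2) • hessian h x := by
    ext μ ν
    exact hU.homogeneous_hessian μ ν t ht x hx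
  rw [hessianDet, h1, Matrix.det_smul, ← Real.rpow_natCast, ← Real.rpow_mul ht.le, mul_comm (D - 2)]
  rfl

theorem hessian_symm (hU : IsDatum D U h) (hx : x ∈ U) (μ ν : κ) :
    hessian h x μ ν = hessian h x ν μ :=
  partialDeriv_comm hU.isOpen hU.smooth hx μ ν

/-- The gradient of `h`. -/
noncomputable def _root_.RMap.grad (h : (κ → ℝ) → ℝ) (x : κ → ℝ) : κ → ℝ :=
  fun μ => partialDeriv μ h x

theorem dotProduct_grad (hU : IsDatum D U h) (hx : x ∈ U) : x ⬝ᵥ grad h x = D * h x :=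
  IsHomogeneousOn.euler hU.homogeneous hU.isOpen hU.smooth hx

/-- Euler's identity for `∂_ν h`, of degree `D - 1`. It makes `x` orthogonal to `ker dh` with
respect to `∂²h`. -/
theorem vecMul_hessian (hU : IsDatum D U h) (hx : x ∈ U) :
    Matrix.vecMul x (hessian h x) = (D - 1) • grad h x := by
  ext ν
  exact (hU.homogeneous_partialDeriv ν).euler hU.isOpen (hU.smooth_partialDeriv ν) hx

theorem hessian_transpose (hU : IsDatum D U h) (hx : x ∈ U) :
    (hessian h x).transpose = hessian h x := by
  ext μ ν
  exact hU.hessian_symm hx ν μ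

theorem hessian_mulVec (hU : IsDatum D U h) (hx : x ∈ U) :
    (hessian h x).mulVec x = (D - 1) • grad h x := by
  rw [← hU.vecMul_hessian hx, ← Matrix.vecMul_transpose, hU.hessian_transpose hx]

/-- The form `-∂²h` is positive definite on the kernel of `dh` at every point of the cone. -/
theorem posDef_ker_grad (hU : IsDatum D U h) (hx : x ∈ U) {w : κ → ℝ}
    (hw : w ⬝ᵥ grad h x = 0) (hw0 : w ≠ 0) : w ⬝ᵥ (hessian h x).mulVec w < 0 := by
  -- The factor that moves `x` to the hypersurface: `h (t x) = t ^ D h x = 1`. It multiplies `dh`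
  -- and `∂²h` by positive numbers, so kernel and sign are preserved.
  set t : ℝ := h x ^ (-D⁻¹) with ht_def
  have hp := hU.pos x hx
  have ht : 0 < t := Real.rpow_pos_of_pos hp _
  have h1 : h (t • x) = 1 := by
    rw [hU.homogeneous t ht x hx, ht_def, ← Real.rpow_mul hp.le, neg_mul,
      inv_mul_cancel₀ hU.degree_pos.ne', Real.rpow_neg_one, inv_mul_cancel₀ hp.ne']
  have h2 : fderiv ℝ h (t • x) w = 0 := by
    have : grad h (t • x) = t ^ (D - 1) • grad h x := by
      ext μ
      exact hU.homogeneous_partialDeriv μ t ht x hx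
    rw [fderiv_eq_sum_partialDeriv]
    change w ⬝ᵥ grad h (t • x) = 0
    rw [this, dotProduct_smul, hw, smul_zero]
  have h3 : hessian h (t • x) = t ^ (D - 2) • hessian h x := by
    ext μ ν
    exact hU.homogeneous_hessian μ ν t ht x hx
  have h4 := hU.posDef_tangent _ (hU.smul_mem t ht x hx) h1 w h2 hw0
  rw [h3, Matrix.neg_mulVec, Matrix.smul_mulVec, dotProduct_neg, dotProduct_smul,
    smul_eq_mul] at h4
  have h5 := Real.rpow_pos_of_pos ht (D - 2)
  by_contra hc
  nlinarith [mul_nonneg h5.le (not_lt.1 hc)]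

/-- Pairing a null vector `v` of `∂²h` with `x` gives `(D - 1) dh(v) = 0`. As `D ≠ 1`, `v` lies in
`ker dh`, where `∂²h` is definite. -/
theorem hessianDet_ne_zero (hU : IsDatum D U h) (hx : x ∈ U) : hessianDet h x ≠ 0 := by
  intro h0
  obtain ⟨v, hv, hv0⟩ := Matrix.exists_mulVec_eq_zero_iff.2 h0
  have h1 : v ⬝ᵥ grad h x = 0 := by
    have h2 : x ⬝ᵥ (hessian h x).mulVec v = (D - 1) * (v ⬝ᵥ grad h x) := by
      rw [Matrix.dotProduct_mulVec, hU.vecMul_hessian hx, smul_dotProduct, dotProduct_comm,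
        smul_eq_mul]
    rw [hv0, dotProduct_zero] at h2
    exact (mul_eq_zero.1 h2.symm).resolve_left (sub_ne_zero.2 hU.degree_ne_one)
  have h3 := hU.posDef_ker_grad hx h1 hv
  rw [hv0, dotProduct_zero] at h3
  exact lt_irrefl _ h3

/-- The metric `-∂² log h` on the cone. -/
noncomputable def _root_.RMap.logMetric (h : (κ → ℝ) → ℝ) : (κ → ℝ) → Matrix κ κ ℝ :=
  hessian fun y => -Real.log (h y)

theorem smooth_neg_log (hU : IsDatum D U h) : ContDiffOn ℝ ∞ (fun y => -Real.log (h y)) U :=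
  (hU.smooth.log fun y hy => (hU.pos y hy).ne').neg

theorem logMetric_eq (hU : IsDatum D U h) (hx : x ∈ U) :
    logMetric h x = (-(h x)⁻¹) • hessian h x
      + (h x ^ 2)⁻¹ • Matrix.vecMulVec (grad h x) (grad h x) := by
  have hl : ContDiffOn ℝ ∞ (fun y => Real.log (h y)) U :=
    hU.smooth.log fun y hy => (hU.pos y hy).ne'
  ext μ ν
  have h1 : logMetric h x μ ν = -hessian (fun y => Real.log (h y)) x μ ν := by
    change partialDeriv μ (partialDeriv ν fun y => -Real.log (h y)) x
      = -partialDeriv μ (partialDeriv ν fun y => Real.log (h y)) x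
    rw [← partialDeriv_neg]
    exact partialDeriv_congr hU.isOpen (fun y _ => partialDeriv_neg _ _ _) hx μ
  rw [h1, hessian_log hU.isOpen hU.smooth (fun y hy => (hU.pos y hy).ne') hx]
  simp only [Matrix.add_apply, Matrix.smul_apply, Matrix.vecMulVec_apply, smul_eq_mul, grad]
  ring

theorem logMetric_symm (hU : IsDatum D U h) (hx : x ∈ U) (μ ν : κ) :
    logMetric h x μ ν = logMetric h x ν μ :=
  partialDeriv_comm hU.isOpen hU.smooth_neg_log hx μ ν

theorem logMetric_quadratic (hU : IsDatum D U h) (hx : x ∈ U) {v : κ → ℝ} (hv : v ≠ 0) :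
    0 < v ⬝ᵥ (logMetric h x).mulVec v := by
  have hp := hU.pos x hx
  have hD := hU.degree_pos
  -- Chosen so that `w = v - t x` lies in `ker dh`. The two parts are orthogonal, and the radial one
  -- contributes `t² D > 0` for `D < 1` as well.
  set t : ℝ := (v ⬝ᵥ grad h x) / (D * h x) with ht
  set w : κ → ℝ := v - t • x with hw
  have hvw : v = w + t • x := by simp [hw]
  have hvg : v ⬝ᵥ grad h x = t * (D * h x) := by
    rw [ht, div_mul_cancel₀ _ (mul_pos hD hp).ne']
  have hwg : w ⬝ᵥ grad h x = 0 := by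
    rw [hw, sub_dotProduct, smul_dotProduct, hU.dotProduct_grad hx, hvg, smul_eq_mul, sub_self]
  have hxw : x ⬝ᵥ (hessian h x).mulVec w = 0 := by
    rw [Matrix.dotProduct_mulVec, hU.vecMul_hessian hx, smul_dotProduct, dotProduct_comm, hwg,
      smul_zero]
  have hHv : v ⬝ᵥ (hessian h x).mulVec v
      = w ⬝ᵥ (hessian h x).mulVec w + t ^ 2 * ((D - 1) * (D * h x)) := by
    conv_lhs => rw [hvw]
    simp only [Matrix.mulVec_add, Matrix.mulVec_smul, add_dotProduct, dotProduct_add,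
      smul_dotProduct, dotProduct_smul, hU.hessian_mulVec hx, hwg, hxw, hU.dotProduct_grad hx,
      smul_eq_mul]
    ring
  have key : v ⬝ᵥ (logMetric h x).mulVec v
      = -(w ⬝ᵥ (hessian h x).mulVec w) / h x + t ^ 2 * D := by
    rw [hU.logMetric_eq hx, Matrix.add_mulVec, Matrix.smul_mulVec, Matrix.smul_mulVec,
      Matrix.vecMulVec_mulVec, dotProduct_add, dotProduct_smul, dotProduct_smul, hHv,
      dotProduct_smul, dotProduct_comm (grad h x) v, hvg]
    simp only [smul_eq_mul, MulOpposite.smul_eq_mul_unop, MulOpposite.unop_op]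
    field_simp
    ring
  rw [key]
  by_cases hw0 : w = 0
  · have ht0 : t ≠ 0 := fun h0 => hv (by rw [hvw, hw0, h0, zero_smul, add_zero])
    rw [hw0]
    simp only [zero_dotProduct, neg_zero, zero_div, zero_add]
    positivity
  · have h1 := div_pos (neg_pos.2 (hU.posDef_ker_grad hx hwg hw0)) hp
    positivity

theorem logMetric_posDef (hU : IsDatum D U h) (hx : x ∈ U) : (logMetric h x).PosDef := by
  refine Matrix.PosDef.of_dotProduct_mulVec_pos ?_ fun v hv => ?_
  · ext μ ν
    simpa using hU.logMetric_symm hx ν μ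
  · simpa using hU.logMetric_quadratic hx hv

theorem isHessianMetric_logMetric (hU : IsDatum D U h) : IsHessianMetric U (logMetric h) where
  isOpen := hU.isOpen
  smooth a b := contDiffOn_partialDeriv hU.isOpen
    (contDiffOn_partialDeriv hU.isOpen hU.smooth_neg_log b) a
  symm x hx := by
    ext μ ν
    exact hU.logMetric_symm hx ν μ
  deriv_symm x hx a b c := partialDeriv_comm hU.isOpen
    (contDiffOn_partialDeriv hU.isOpen hU.smooth_neg_log c) hx a b
  det_ne_zero x hx := (hU.logMetric_posDef hx).det_pos.ne'

theorem det_logMetric (hU : IsDatum D U h) (hx : x ∈ U) :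
    (logMetric h x).det
      = (-(h x)⁻¹) ^ Fintype.card κ * (hessianDet h x * (-(D - 1)⁻¹)) := by
  have hp := (hU.pos x hx).ne'
  have hD : D - 1 ≠ 0 := sub_ne_zero.2 hU.degree_ne_one
  -- Since `dh = ∂²h x / (D - 1)`, the factor `∂²h` splits off on the left. The matrix determinant
  -- lemma then gives `1 - D / (D - 1) = -1 / (D - 1)`.
  have h1 : logMetric h x = (-(h x)⁻¹) • (hessian h x
      * (1 + Matrix.replicateCol Unit (-((D - 1) * h x)⁻¹ • x)
        * Matrix.replicateRow Unit (grad h x))) := by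
    rw [hU.logMetric_eq hx, Matrix.mul_add, Matrix.mul_one, smul_add,
      ← Matrix.vecMulVec_eq, Matrix.mul_vecMulVec, Matrix.mulVec_smul, hU.hessian_mulVec hx,
      smul_smul, Matrix.smul_vecMulVec, smul_smul]
    congr 2
    field_simp
  rw [h1, Matrix.det_smul, Matrix.det_mul, Matrix.det_one_add_replicateCol_mul_replicateRow,
    dotProduct_smul, dotProduct_comm, hU.dotProduct_grad hx, hessianDet]
  congr 2
  rw [smul_eq_mul]
  field_simp
  ring

/-- The Sherman–Morrison formula: the correction is a multiple of `x xᵀ` because `(-∂²h)⁻¹ dh = -x /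
(D - 1)`. -/
theorem logMetric_inv (hU : IsDatum D U h) (hx : x ∈ U) :
    (logMetric h x)⁻¹ = h x • raise h x + (D - 1)⁻¹ • Matrix.vecMulVec x x := by
  have hp := (hU.pos x hx).ne'
  have hD : D - 1 ≠ 0 := sub_ne_zero.2 hU.degree_ne_one
  have hr : raise h x * hessian h x = -1 := by
    have h1 : IsUnit (-hessian h x).det := by
      rw [Matrix.det_neg]
      exact (mul_ne_zero (by simp) (hU.hessianDet_ne_zero hx)).isUnit
    rw [← neg_neg (hessian h x), Matrix.mul_neg, raise,
      Matrix.nonsing_inv_mul _ h1]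
  have hg : (raise h x).mulVec (grad h x) = -((D - 1)⁻¹ • x) := by
    have h1 : grad h x = (D - 1)⁻¹ • (hessian h x).mulVec x := by
      rw [hU.hessian_mulVec hx, smul_smul, inv_mul_cancel₀ hD, one_smul]
    rw [h1, Matrix.mulVec_smul, Matrix.mulVec_mulVec, hr, Matrix.neg_mulVec, Matrix.one_mulVec,
      smul_neg]
  refine Matrix.inv_eq_left_inv ?_
  rw [hU.logMetric_eq hx]
  simp only [Matrix.add_mul, Matrix.mul_add, Matrix.smul_mul, Matrix.mul_smul, hr,
    Matrix.mul_vecMulVec, hg, Matrix.vecMulVec_mul, hU.vecMul_hessian hx, Matrix.add_mulVec,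
    Matrix.smul_mulVec, Matrix.vecMulVec_mulVec, hU.dotProduct_grad hx, op_smul_eq_smul]
  ext μ ν
  simp only [Matrix.add_apply, Matrix.smul_apply, Matrix.neg_apply, Matrix.vecMulVec_apply,
    Pi.add_apply, Pi.neg_apply, Pi.smul_apply, smul_eq_mul]
  field_simp
  ring

end IsDatum

/-! ### Wirtinger derivatives of functions of the imaginary part -/

section Wirtinger

variable {κ : Type*} [Fintype κ] [DecidableEq κ] {U : Set (κ → ℝ)}

theorem fderiv_ofReal_comp_imPart {f : (κ → ℝ) → ℝ} {z : κ → ℂ}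
    (hf : DifferentiableAt ℝ f (imPart z)) (v : κ → ℂ) :
    fderiv ℝ (fun w => (f (imPart w) : ℂ)) z v = (fderiv ℝ f (imPart z) (imPart v) : ℝ) := by
  have h1 : HasFDerivAt (fun x => (f x : ℂ)) (Complex.ofRealCLM ∘L fderiv ℝ f (imPart z))
      (imPart z) := Complex.ofRealCLM.hasFDerivAt.comp (imPart z) hf.hasFDerivAt
  rw [fderiv_comp_imPart (f := fun x => (f x : ℂ)) h1.differentiableAt, h1.fderiv]
  rfl

theorem differentiableAt_ofReal_comp_imPart {f : (κ → ℝ) → ℝ} {z : κ → ℂ}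
    (hf : DifferentiableAt ℝ f (imPart z)) :
    DifferentiableAt ℝ (fun w => (f (imPart w) : ℂ)) z :=
  (Complex.ofRealCLM.hasFDerivAt.comp z
    (HasFDerivAt.comp z (f := imPart) hf.hasFDerivAt (imPartCLM κ).hasFDerivAt)).differentiableAt

theorem dzbar_ofReal_comp_imPart {f : (κ → ℝ) → ℝ} {z : κ → ℂ}
    (hf : DifferentiableAt ℝ f (imPart z)) (ν : κ) :
    dzbar ν (fun w => (f (imPart w) : ℂ)) z
      = Complex.I / 2 * (partialDeriv ν f (imPart z) : ℂ) := by
  rw [dzbar, fderiv_ofReal_comp_imPart hf, fderiv_ofReal_comp_imPart hf, imPart_single,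
    imPart_single]
  simp only [Complex.one_im, Complex.I_im, Pi.single_zero, map_zero, partialDeriv]
  push_cast
  ring

/-- On functions of `x`, `∂_z̄` is `(i/2) ∂_x` and `∂_z` is `-(i/2) ∂_x`. -/
theorem dz_dzbar_ofReal_comp_imPart (hU : IsOpen U) {f : (κ → ℝ) → ℝ} (hf : ContDiffOn ℝ ∞ f U)
    {z : κ → ℂ} (hz : z ∈ tube U) (μ ν : κ) :
    dz μ (dzbar ν fun w => (f (imPart w) : ℂ)) z = (1 / 4) * (hessian f (imPart z) μ ν : ℂ) := by
  have hd := differentiableAt_of_smooth hU (contDiffOn_partialDeriv hU hf ν) hz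
  have h1 : (dzbar ν fun w => (f (imPart w) : ℂ)) =ᶠ[nhds z]
      fun w => Complex.I / 2 * (partialDeriv ν f (imPart w) : ℂ) :=
    Filter.eventually_of_mem ((isOpen_tube hU).mem_nhds hz) fun w hw =>
      dzbar_ofReal_comp_imPart (differentiableAt_of_smooth hU hf hw) ν
  rw [dz, h1.fderiv_eq, fderiv_const_mul (differentiableAt_ofReal_comp_imPart hd)]
  simp only [smul_apply, fderiv_ofReal_comp_imPart hd, imPart_single, Complex.one_im,
    Complex.I_im, Pi.single_zero, map_zero, smul_eq_mul]
  change _ = 1 / 4 * (partialDeriv μ (partialDeriv ν f) (imPart z) : ℂ)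
  rw [partialDeriv.eq_1 μ (partialDeriv ν f)]
  push_cast
  linear_combination (-(1 / 4) * (fderiv ℝ (partialDeriv ν f) (imPart z) (Pi.single μ 1) : ℂ))
    * Complex.I_sq

theorem kaehlerMetric_comp_imPart (hU : IsOpen U) {f : (κ → ℝ) → ℝ} (hf : ContDiffOn ℝ ∞ f U)
    {z : κ → ℂ} (hz : z ∈ tube U) :
    kaehlerMetric (fun w => f (imPart w)) z
      = (1 / 2 : ℝ) • Matrix.fromBlocks (hessian f (imPart z)) 0 0 (hessian f (imPart z)) := by
  have hs : ∀ a b, hessian f (imPart z) a b = hessian f (imPart z) b a :=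
    fun a b => partialDeriv_comm hU hf hz a b
  have hc : ∀ μ ν, hermCoeff (fun w => f (imPart w)) z μ ν
      = (1 / 4) * (hessian f (imPart z) μ ν : ℂ) := dz_dzbar_ofReal_comp_imPart hU hf hz
  -- Evaluates the second summand of the metric, in which the roles of the two vectors are
  -- exchanged.
  have hite : ∀ (P : κ → κ → ℂ) (a b : κ),
      (∑ μ, ∑ ν, if μ = b then if ν = a then P μ ν else 0 else 0) = P b a := fun P a b => by
    rw [Finset.sum_eq_single b (fun μ _ hμ => by simp [hμ]) (by simp)]
    simp
  ext i j
  rcases i with a | a <;> rcases j with b | b <;>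
    simp only [kaehlerMetric, Matrix.of_apply, hc, coordVec, Matrix.smul_apply,
      Matrix.fromBlocks_apply₁₁, Matrix.fromBlocks_apply₁₂, Matrix.fromBlocks_apply₂₁,
      Matrix.fromBlocks_apply₂₂, mul_add, Finset.sum_add_distrib, Pi.single_apply, apply_ite,
      map_one, map_zero, Complex.conj_I, ite_mul, mul_zero, zero_mul, mul_one,
      Finset.sum_ite_eq', Finset.mem_univ, if_true, Matrix.zero_apply, hite]
  all_goals
    rw [hs b a]
    simp [Complex.add_re, Complex.mul_re]
    try ring

end Wirtinger

/-! ### Curvature of the r-map metric -/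

namespace IsDatum

variable {κ : Type*} [Fintype κ] [DecidableEq κ] {U : Set (κ → ℝ)} {D : ℝ} {h : (κ → ℝ) → ℝ}
variable {x : κ → ℝ} {z : κ → ℂ}

theorem rMetric_eq (hU : IsDatum D U h) (hz : z ∈ tube U) :
    rMetric h z
      = (1 / 2 : ℝ) • Matrix.fromBlocks (logMetric h (imPart z)) 0 0 (logMetric h (imPart z)) :=
  kaehlerMetric_comp_imPart hU.isOpen hU.smooth_neg_log hz

theorem rMetric_posDef (hU : IsDatum D U h) (hz : z ∈ tube U) : (rMetric h z).PosDef := by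
  have hp := hU.logMetric_posDef hz
  rw [hU.rMetric_eq hz]
  refine Matrix.PosDef.smul ?_ (by norm_num)
  refine Matrix.PosDef.of_dotProduct_mulVec_pos ?_ fun v hv => ?_
  · exact Matrix.IsHermitian.fromBlocks hp.1 (by simp) hp.1
  · rw [← Sum.elim_comp_inl_inr v] at hv ⊢
    set p := v ∘ Sum.inl
    set q := v ∘ Sum.inr
    have e : star (Sum.elim p q)
        ⬝ᵥ (Matrix.fromBlocks (logMetric h (imPart z)) 0 0 (logMetric h (imPart z))).mulVec
          (Sum.elim p q)
        = p ⬝ᵥ (logMetric h (imPart z)).mulVec p + q ⬝ᵥ (logMetric h (imPart z)).mulVec q := by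
      rw [Matrix.fromBlocks_mulVec]
      simp [dotProduct]
    rw [e]
    have hn : ∀ r : κ → ℝ, 0 ≤ r ⬝ᵥ (logMetric h (imPart z)).mulVec r := fun r => by
      by_cases hr : r = 0
      · simp [hr]
      · exact (hU.logMetric_quadratic hz hr).le
    by_cases hp0 : p = 0
    · refine add_pos_of_nonneg_of_pos (hn p) (hU.logMetric_quadratic hz fun hq0 => hv ?_)
      rw [hp0, hq0]
      ext i
      rcases i with i | i <;> rfl
    · exact add_pos_of_pos_of_nonneg (hU.logMetric_quadratic hz hp0) (hn q)

/-- `Real.log` ignores signs, so the absolute value can be dropped and `log d` differentiated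
whatever the sign of `d`. -/
theorem log_abs_hessianDet_div (hU : IsDatum D U h) (hx : x ∈ U) (m : ℕ) :
    Real.log (|hessianDet h x| / h x ^ m)
      = Real.log (hessianDet h x) - m * Real.log (h x) := by
  rw [Real.log_div (abs_ne_zero.2 (hU.hessianDet_ne_zero hx)) (pow_pos (hU.pos x hx) m).ne',
    Real.log_abs, Real.log_pow]

theorem smooth_log_hessianDet (hU : IsDatum D U h) :
    ContDiffOn ℝ ∞ (fun y => Real.log (hessianDet h y)) U :=
  hU.smooth_hessianDet.log fun _ hy => hU.hessianDet_ne_zero hy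

theorem smooth_log (hU : IsDatum D U h) : ContDiffOn ℝ ∞ (fun y => Real.log (h y)) U :=
  hU.smooth.log fun y hy => (hU.pos y hy).ne'

theorem smooth_log_abs_hessianDet_div (hU : IsDatum D U h) (m : ℕ) :
    ContDiffOn ℝ ∞ (fun y => Real.log (|hessianDet h y| / h y ^ m)) U :=
  (hU.smooth_log_hessianDet.sub (contDiffOn_const.mul hU.smooth_log)).congr
    fun _ hy => hU.log_abs_hessianDet_div hy m

/-- By the same convention the signs in `det_logMetric` disappear, and `Real.log (D - 1)⁻¹` is a
harmless constant also for `D < 1`. -/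
theorem log_det_logMetric (hU : IsDatum D U h) (hx : x ∈ U) :
    Real.log (logMetric h x).det
      = Real.log (|hessianDet h x| / h x ^ Fintype.card κ) + Real.log (D - 1)⁻¹ := by
  have hp := (hU.pos x hx).ne'
  have hD : (D - 1)⁻¹ ≠ 0 := inv_ne_zero (sub_ne_zero.2 hU.degree_ne_one)
  have hd := hU.hessianDet_ne_zero hx
  rw [hU.det_logMetric hx, hU.log_abs_hessianDet_div hx,
    Real.log_mul (pow_ne_zero _ (neg_ne_zero.2 (inv_ne_zero hp)))
      (mul_ne_zero hd (neg_ne_zero.2 hD)),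
    Real.log_mul hd (neg_ne_zero.2 hD), Real.log_pow, Real.log_neg_eq_log, Real.log_neg_eq_log,
    Real.log_inv (h x)]
  ring

theorem hessian_log_det_logMetric (hU : IsDatum D U h) (hx : x ∈ U) (μ ν : κ) :
    hessian (fun y => Real.log (logMetric h y).det) x μ ν
      = hessian (fun y => Real.log (|hessianDet h y| / h y ^ Fintype.card κ)) x μ ν := by
  have hs := hU.smooth_log_abs_hessianDet_div (Fintype.card κ)
  refine partialDeriv_congr hU.isOpen (fun y hy => ?_) hx μ
  rw [partialDeriv_congr hU.isOpen (fun w hw => hU.log_det_logMetric hw) hy,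
    partialDeriv_add (differentiableAt_of_smooth hU.isOpen hs hy) (differentiableAt_const _),
    partialDeriv_const, add_zero]

theorem hessian_log_abs_hessianDet_div (hU : IsDatum D U h) (hx : x ∈ U) (m : ℕ) (μ ν : κ) :
    hessian (fun y => Real.log (|hessianDet h y| / h y ^ m)) x μ ν
      = hessian (hessianDet h) x μ ν / hessianDet h x
        - partialDeriv μ (hessianDet h) x * partialDeriv ν (hessianDet h) x
          / hessianDet h x ^ 2
        + m * logMetric h x μ ν := by
  have h1 := hessian_log hU.isOpen hU.smooth_hessianDet
    (fun y hy => hU.hessianDet_ne_zero hy) hx μ ν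
  rw [← h1]
  have d1 : ∀ y ∈ U, DifferentiableAt ℝ (fun y => Real.log (hessianDet h y)) y :=
    fun y hy => differentiableAt_of_smooth hU.isOpen hU.smooth_log_hessianDet hy
  have d2 : ∀ y ∈ U, DifferentiableAt ℝ (fun y => -Real.log (h y)) y :=
    fun y hy => differentiableAt_of_smooth hU.isOpen hU.smooth_neg_log hy
  have d2' : ∀ y ∈ U, DifferentiableAt ℝ (fun y => m * -Real.log (h y)) y :=
    fun y hy => (d2 y hy).const_mul _
  have p1 := differentiableAt_of_smooth hU.isOpen
    (contDiffOn_partialDeriv hU.isOpen hU.smooth_log_hessianDet ν) hx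
  have p2 := differentiableAt_of_smooth hU.isOpen
    (contDiffOn_partialDeriv hU.isOpen hU.smooth_neg_log ν) hx
  have p2' : DifferentiableAt ℝ
      (fun y => (m : ℝ) * partialDeriv ν (fun y => -Real.log (h y)) y) x := p2.const_mul _
  have h2 : ∀ y ∈ U, partialDeriv ν (fun y => Real.log (|hessianDet h y| / h y ^ m)) y
      = partialDeriv ν (fun y => Real.log (hessianDet h y)) y
        + m * partialDeriv ν (fun y => -Real.log (h y)) y := fun y hy => by
    rw [partialDeriv_congr hU.isOpen (g := fun w => Real.log (hessianDet h w)
        + m * -Real.log (h w)) (fun w hw => by rw [hU.log_abs_hessianDet_div hw]; ring) hy,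
      partialDeriv_add (d1 y hy) (d2' y hy), partialDeriv_const_mul (d2 y hy)]
  change partialDeriv μ (partialDeriv ν _) x = partialDeriv μ (partialDeriv ν _) x
    + m * partialDeriv μ (partialDeriv ν _) x
  rw [partialDeriv_congr hU.isOpen h2 hx, partialDeriv_add p1 p2', partialDeriv_const_mul p2]

theorem ricciHol_rMetric (hU : IsDatum D U h) (hz : z ∈ tube U) (μ ν : κ) :
    ricciHol (rMetric h) μ ν z
      = -dz μ (dzbar ν fun w => (Real.log (|hessianDet h (imPart w)|
          / h (imPart w) ^ Fintype.card κ) : ℂ)) z := by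
  have hk := hU.isHessianMetric_logMetric
  have hg : ∀ w ∈ tube U, rMetric h w = _ := fun w hw => hU.rMetric_eq hw
  rw [dz_dzbar_ofReal_comp_imPart hU.isOpen (hU.smooth_log_abs_hessianDet_div _) hz, ricciHol,
    ricci_tube_inl_inl hk hg hz, ricci_tube_inl_inr hk hg hz, ricci_tube_inr_inl hk hg hz,
    ricci_tube_inr_inr hk hg hz, hU.hessian_log_det_logMetric hz]
  push_cast
  ring

/-- Euler's identities for `d = det ∂²h`, combined to `x^μ x^ν ∂_μ ∂_ν log |d| = -m (D - 2)`. -/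
theorem hessian_log_hessianDet_radial (hU : IsDatum D U h) (hx : x ∈ U) :
    ∑ μ, ∑ ν, x μ * x ν * (hessian (hessianDet h) x μ ν / hessianDet h x
        - partialDeriv μ (hessianDet h) x * partialDeriv ν (hessianDet h) x
          / hessianDet h x ^ 2)
      = -(Fintype.card κ * (D - 2)) := by
  set e : ℝ := Fintype.card κ * (D - 2) with he
  have hd := hU.hessianDet_ne_zero hx
  have h1 : ∑ μ, x μ * partialDeriv μ (hessianDet h) x = e * hessianDet h x :=
    hU.homogeneous_hessianDet.euler hU.isOpen hU.smooth_hessianDet hx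
  have h2 : ∀ ν, ∑ μ, x μ * hessian (hessianDet h) x μ ν
      = (e - 1) * partialDeriv ν (hessianDet h) x := fun ν =>
    (hU.homogeneous_hessianDet.partialDeriv hU.isOpen hU.smul_mem hU.smooth_hessianDet ν).euler
      hU.isOpen (contDiffOn_partialDeriv hU.isOpen hU.smooth_hessianDet ν) hx
  have h3 : ∑ μ, ∑ ν, x μ * x ν * hessian (hessianDet h) x μ ν
      = (e - 1) * (e * hessianDet h x) := by
    rw [Finset.sum_comm, ← h1, Finset.mul_sum]
    refine Finset.sum_congr rfl fun ν _ => ?_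
    rw [mul_left_comm, ← h2 ν, Finset.mul_sum]
    exact Finset.sum_congr rfl fun μ _ => by ring
  have h4 : ∑ μ, ∑ ν, x μ * x ν * (partialDeriv μ (hessianDet h) x
      * partialDeriv ν (hessianDet h) x) = (e * hessianDet h x) ^ 2 := by
    rw [← h1, sq, Finset.sum_mul_sum]
    exact Finset.sum_congr rfl fun μ _ => Finset.sum_congr rfl fun ν _ => by ring
  simp only [mul_sub, ← mul_div_assoc, Finset.sum_sub_distrib, ← Finset.sum_div]
  -- With `e` the degree of `d`, the total is `e (e - 1) - e² = -e`.
  rw [h3, h4]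
  field_simp
  ring

theorem scal_rMetric (hU : IsDatum D U h) (hz : z ∈ tube U) :
    scal (rMetric h) z
      = -(Fintype.card κ : ℝ) ^ 2 + (D - 2) / (D - 1) * Fintype.card κ
        - h (imPart z) / hessianDet h (imPart z) * traceHessianDet h (imPart z)
        + h (imPart z) / hessianDet h (imPart z) ^ 2 * normSqGradHessianDet h (imPart z) := by
  have hk := hU.isHessianMetric_logMetric
  have hg : ∀ w ∈ tube U, rMetric h w = _ := fun w hw => hU.rMetric_eq hw
  have hx : imPart z ∈ U := hz
  set x := imPart z with hxz
  have hD : D - 1 ≠ 0 := sub_ne_zero.2 hU.degree_ne_one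
  have htr : ∑ μ, ∑ ν, (logMetric h x)⁻¹ μ ν * logMetric h x μ ν = Fintype.card κ := by
    rw [← Matrix.trace_one (n := κ) (R := ℝ),
      ← Matrix.nonsing_inv_mul (logMetric h x) (hk.det_ne_zero x hx).isUnit, Matrix.trace]
    simp only [Matrix.diag_apply, Matrix.mul_apply]
    exact Finset.sum_congr rfl fun μ _ => Finset.sum_congr rfl fun ν _ => by
      rw [hU.logMetric_symm hx μ ν]
  -- The two equal blocks double the trace, `g⁻¹` contributes `2` and Ricci `-½`; with the prefactor
  -- `½` the coefficient is `-1`.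
  have h1 : scal (rMetric h) z = -∑ μ, ∑ ν, (logMetric h x)⁻¹ μ ν
      * hessian (fun y => Real.log (|hessianDet h y| / h y ^ Fintype.card κ)) x μ ν := by
    rw [scal, hU.rMetric_eq hz, inv_smul_fromBlocks_diag (hk.det_ne_zero _ hz)]
    simp only [Fintype.sum_sum_type, ricci_tube_inl_inl hk hg hz, ricci_tube_inl_inr hk hg hz,
      ricci_tube_inr_inl hk hg hz, ricci_tube_inr_inr hk hg hz, Matrix.smul_apply,
      Matrix.fromBlocks_apply₁₁, Matrix.fromBlocks_apply₂₂, mul_zero,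
      add_zero, zero_add, smul_eq_mul, hU.hessian_log_det_logMetric hx, ← hxz,
      Finset.mul_sum, ← Finset.sum_add_distrib, ← Finset.sum_neg_distrib]
    exact Finset.sum_congr rfl fun μ _ => Finset.sum_congr rfl fun ν _ => by ring
  have h2 := hU.hessian_log_hessianDet_radial hx
  -- The two parts of `k⁻¹` act on `∂² log |d|`: the multiple of `raise` gives the terms in `d`, and
  -- `x xᵀ` the radial sum `h2`.
  have h3 : ∑ μ, ∑ ν, (logMetric h x)⁻¹ μ ν
      * hessian (fun y => Real.log (|hessianDet h y| / h y ^ Fintype.card κ)) x μ ν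
      = h x / hessianDet h x * traceHessianDet h x
        - h x / hessianDet h x ^ 2 * normSqGradHessianDet h x
        + (D - 1)⁻¹ * (-(Fintype.card κ * (D - 2)))
        + Fintype.card κ * ∑ μ, ∑ ν, (logMetric h x)⁻¹ μ ν * logMetric h x μ ν := by
    rw [← h2]
    simp only [traceHessianDet, normSqGradHessianDet, Finset.mul_sum, ← Finset.sum_sub_distrib,
      ← Finset.sum_add_distrib]
    refine Finset.sum_congr rfl fun μ _ => Finset.sum_congr rfl fun ν _ => ?_
    rw [hU.hessian_log_abs_hessianDet_div hx, mul_add, hU.logMetric_inv hx]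
    simp only [Matrix.add_apply, Matrix.smul_apply, Matrix.vecMulVec_apply, smul_eq_mul]
    ring
  have hd := hU.hessianDet_ne_zero hx
  rw [h1, h3, htr]
  field_simp
  ring

end IsDatum
end RMap

/-- The Ricci tensor and the scalar curvature of a manifold `M = ℝ^m + i U`, `m = n + 1`, in the
image of the generalized supergravity r-map. As `d` may be negative, the logarithm is taken of
its absolute value; the first two conclusions say that all expressions are meaningful. -/
theorem corollary5p4 (n : ℕ) (D : ℝ) (U : Set (Fin (n + 1) → ℝ)) (h : (Fin (n + 1) → ℝ) → ℝ)
    (hU : RMap.IsDatum D U h) :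
    (∀ x ∈ U, RMap.hessianDet h x ≠ 0) ∧
    ∀ z ∈ RMap.tube U,
      (RMap.rMetric h z).PosDef ∧
      (∀ μ ν : Fin (n + 1),
        RMap.ricciHol (RMap.rMetric h) μ ν z =
          -RMap.dz μ (RMap.dzbar ν fun w =>
            (Real.log (|RMap.hessianDet h (RMap.imPart w)|
              / h (RMap.imPart w) ^ (n + 1)) : ℂ)) z) ∧
      RMap.scal (RMap.rMetric h) z =
        -((n + 1 : ℕ) : ℝ) ^ 2 + (D - 2) / (D - 1) * ((n + 1 : ℕ) : ℝ)
          - h (RMap.imPart z) / RMap.hessianDet h (RMap.imPart z)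
            * RMap.traceHessianDet h (RMap.imPart z)
          + h (RMap.imPart z) / RMap.hessianDet h (RMap.imPart z) ^ 2
            * RMap.normSqGradHessianDet h (RMap.imPart z) := by
  refine ⟨fun x hx => hU.hessianDet_ne_zero hx, fun z hz =>
    ⟨hU.rMetric_posDef hz, fun μ ν => ?_, ?_⟩⟩
  · simpa only [Fintype.card_fin] using hU.ricciHol_rMetric hz μ ν
  · simpa only [Fintype.card_fin] using hU.scal_rMetric hz
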